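/- Let $d\ge 1$ and $\beta>0$. A pair potential on $\mathbb{R}^d$ is a (measurable) function $V:[0,\infty)\to(-\infty,+\infty]$, evaluated at $|x|$, $x\in\mathbb{R}^d$, with $|\cdot|$ the Euclidean norm. It is stable if there is $B\ge 0$ with $$\sum_{1\le i<j\le N}V(|x_i-x_j|)\ge -BN\qquad\text{for all } N\in\mathbb{N},\ (x_1,\dots,x_N)\in(\mathbb{R}^{d})^N,$$ and its stability constant is the infimum of such $B$. It is tempered if $\int_{|x|\ge r_0}|V(|x|)|\,dx<\infty$ for some $r_0\ge 0$, and absolutely integrable if $\int_{\mathbb{R}^d}|V(|x|)|\,dx<\infty$. For a cubic box $\Lambda\subset\mathbb{R}^d$ with volume $|\Lambda|>0$ and $n\ge 1$, the $n$-th order Mayer coefficient is $$C_n(\beta,\Lambda)=\frac{1}{|\Lambda|}\frac{1}{n!}\int_{\Lambda}dx_1\cdots\int_{\Lambda}dx_n\sum_{g\in G_n}\prod_{\{i,j\}\in E_g}\left[e^{-\beta V(|x_i-x_j|)}-1\right],$$ where $G_n$ is the set of connected graphs with vertex set $\{1,\dots,n\}$, $E_g$ is the edge set of $g$, and $e^{-\infty}=0$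 (so $C_1(\beta,\Lambda)=1$). Let $V=\Phi_1+\Phi_2$ be a Ruelle potential, that is, $V$ is a stable and tempered pair potential, $\Phi_1$ is a non-negative tempered pair potential, and $\Phi_2$ is a stable and absolutely integrable pair potential. Let $\tilde B$ be the stability constant of $\Phi_2$ and $$\tilde C(\beta)=\int_{\mathbb{R}^d}\left[\,|e^{-\beta\Phi_1(|x|)}-1|+\beta|\Phi_2(|x|)|\,\right]dx .$$ Then $\tilde C(\beta)<\infty$ and, for every cubic box $\Lambda$ and every $n\ge 1$, the integral defining $C_n(\beta,\Lambda)$ converges absolutely and $$|C_n(\beta,\Lambda)|\le e^{\beta\tilde B n}\,n^{n-2}\,\frac{[\tilde C(\beta)]^{n-1}}{n!}.$$ Consequently, for every complex $\lambda$ with $$|\lambda|<\frac{1}{e^{\beta\tilde B+1}\,\tilde C(\beta)}$$ (every $\lambda\in\mathbb{C}$ if $\tilde C(\beta)=0$) the Mayer series $\sum_{n\ge1}C_n(\beta,\Lambda)\lambda^n$ converges absolutely, uniformly in the cubic box $\Lambda$. -/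

import Mathlib

open MeasureTheory Filter
open scoped NNReal ENNReal Nat

noncomputable section

namespace MayerGas

/-- A (translation and rotation invariant) pair potential on `ℝ^d`: a function `V` from `[0, ∞)` to
`(-∞, +∞]` such that `x ↦ V (|x|)` is Lebesgue measurable on `ℝ^d`. -/
structure IsPairPotential (d : ℕ) (V : ℝ≥0 → EReal) : Prop where
  ne_bot : ∀ r, V r ≠ ⊥
  aemeasurable : AEMeasurable (fun x : EuclideanSpace ℝ (Fin d) => V ‖x‖₊) volume

/-- The energy `∑_{1 ≤ i < j ≤ N} V (|x_i - x_j|)` of `N` particles. -/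
def energy {d N : ℕ} (V : ℝ≥0 → EReal) (x : Fin N → EuclideanSpace ℝ (Fin d)) : EReal :=
  ∑ i, ∑ j ∈ Finset.Ioi i, V ‖x i - x j‖₊

/-- The constants `B ≥ 0` with `∑_{i < j} V (|x_i - x_j|) ≥ - B N` for all `N` and all
configurations of `N` particles in `ℝ^d`. -/
def stabilityBounds (d : ℕ) (V : ℝ≥0 → EReal) : Set ℝ :=
  {B | 0 ≤ B ∧ ∀ (N : ℕ) (x : Fin N → EuclideanSpace ℝ (Fin d)),
    ((-(B * N) : ℝ) : EReal) ≤ energy V x}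

/-- Stable pair potentials. -/
def IsStable (d : ℕ) (V : ℝ≥0 → EReal) : Prop :=
  ∃ B, B ∈ stabilityBounds d V

/-- The stability constant of a stable pair potential: the infimum of the admissible `B`. -/
def stabilityConst (d : ℕ) (V : ℝ≥0 → EReal) : ℝ :=
  sInf (stabilityBounds d V)

/-- Tempered pair potentials: `∫_{|x| ≥ r₀} |V (|x|)| dx < ∞` for some `r₀ ≥ 0`. -/
def IsTempered (d : ℕ) (V : ℝ≥0 → EReal) : Prop :=
  ∃ r₀ : ℝ, 0 ≤ r₀ ∧
    ∫⁻ x in {x : EuclideanSpace ℝ (Fin d) | r₀ ≤ ‖x‖}, (V ‖x‖₊).abs < ∞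

/-- Absolutely integrable pair potentials: `∫ |V (|x|)| dx < ∞`. -/
def IsAbsIntegrable (d : ℕ) (V : ℝ≥0 → EReal) : Prop :=
  ∫⁻ x : EuclideanSpace ℝ (Fin d), (V ‖x‖₊).abs < ∞

/-- Admissible pair potentials: stable and tempered. -/
structure IsAdmissible (d : ℕ) (V : ℝ≥0 → EReal) : Prop where
  isPairPotential : IsPairPotential d V
  stable : IsStable d V
  tempered : IsTempered d V

/-- `V = Φ₁ + Φ₂` is a Ruelle potential on `ℝ^d` (with this decomposition): `V` is admissible, `Φ₁`
is non-negative and tempered, `Φ₂` is stable and absolutely integrable. -/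
structure IsRuelle (d : ℕ) (V Φ₁ Φ₂ : ℝ≥0 → EReal) : Prop where
  admissible : IsAdmissible d V
  eq_add : ∀ r, V r = Φ₁ r + Φ₂ r
  isPairPotential₁ : IsPairPotential d Φ₁
  nonneg₁ : ∀ r, 0 ≤ Φ₁ r
  tempered₁ : IsTempered d Φ₁
  isPairPotential₂ : IsPairPotential d Φ₂
  stable₂ : IsStable d Φ₂
  absIntegrable₂ : IsAbsIntegrable d Φ₂

/-- `e^{-β v}` for `v ∈ (-∞, +∞]` and `β > 0`, with `e^{-∞} = 0`. -/
def boltzmann (β : ℝ) (v : EReal) : ℝ :=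
  (EReal.exp (-((β : EReal) * v))).toReal

open Classical in
/-- `∑_g ∏_{{i,j} ∈ E_g} (e^{-β V (|x_i - x_j|)} - 1)`, the sum over all connected graphs `g` on the
`n` vertices; each edge `{i, j}` is listed once, as the pair with `i < j`. -/
def ursell {d n : ℕ} (β : ℝ) (V : ℝ≥0 → EReal) (x : Fin n → EuclideanSpace ℝ (Fin d)) : ℝ :=
  ∑ g : SimpleGraph (Fin n) with g.Connected,
    ∏ p : Fin n × Fin n with p.1 < p.2 ∧ g.Adj p.1 p.2,
      (boltzmann β (V ‖x p.1 - x p.2‖₊) - 1)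

/-- The configurations of `n` particles in `Λ`, that is `Λ^n`. -/
def configs {d : ℕ} (n : ℕ) (Λ : Set (EuclideanSpace ℝ (Fin d))) :
    Set (Fin n → EuclideanSpace ℝ (Fin d)) :=
  {x | ∀ i, x i ∈ Λ}

/-- The `n`-th order Mayer coefficient `C_n(β, Λ)`. For `n = 1` the only connected graph has no
edge, and the formula gives `C_1(β, Λ) = 1`. -/
def mayerCoeff {d : ℕ} (β : ℝ) (V : ℝ≥0 → EReal) (n : ℕ)
    (Λ : Set (EuclideanSpace ℝ (Fin d))) : ℝ :=
  1 / (volume Λ).toReal * (1 / (n ! : ℝ)) * ∫ x in configs n Λ, ursell β V x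

/-- Cubic boxes in `ℝ^d`, of side `L > 0`. -/
def IsCubicBox {d : ℕ} (Λ : Set (EuclideanSpace ℝ (Fin d))) : Prop :=
  ∃ (a : EuclideanSpace ℝ (Fin d)) (L : ℝ), 0 < L ∧
    Λ = {x | ∀ i, x i ∈ Set.Icc (a i) (a i + L)}

/-- `∫ (|e^{-β Φ₁(|x|)} - 1| + β |Φ₂(|x|)|) dx`, as an element of `[0, ∞]`. -/
def ruelleIntegral (d : ℕ) (β : ℝ) (Φ₁ Φ₂ : ℝ≥0 → EReal) : ℝ≥0∞ :=
  ∫⁻ x : EuclideanSpace ℝ (Fin d),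
    (ENNReal.ofReal |boltzmann β (Φ₁ ‖x‖₊) - 1| + ENNReal.ofReal β * (Φ₂ ‖x‖₊).abs)

end MayerGas

end

namespace MayerGas

/-! ### Tree-graph inequality for signed sums over connected graphs -/

section SpanningSums

open SimpleGraph

variable {V : Type*}

/-! The core is a pointwise tree-graph inequality for the Ursell function, with stability charged
once and globally. Pairs are decided one at a time while a forest `H` is grown. If the ends of a
pair `e` are already connected in `H`, keeping or dropping `e` makes no difference to connectedness,
and the two choices combine to the factor `1 + f e`, of modulus at most `exp (-u e)`. Otherwise `e`
extends the forest and costs `|f e|`. Repeating this turns the sum over connected graphs into a sum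
over trees, weighted by Boltzmann factors of the pairs inside clusters.

The energy used is `u = β Φ₂` alone: since `Φ₁ ≥ 0`, its Boltzmann factor is at most one and enters
only through the edge weights. Thus the constant is that of `Φ₂`. An edge satisfies `|f| ≤ exp (-min
u 0) * F`, where `F` is the integrand of `C̃(β)`. The spurious exponential on negative pairs would
ruin a naive estimate. Here the negative pairs are decided before the others, and each exponential
is counted as the energy of a pair internal to the final clusters (`abs_spanSum_union_le`).
Stability applied to each cluster separately bounds the total internal energy below by `-β B̃ n`,
because cluster sizes add up to `n` (`neg_le_innerSum_of_mem_stabilityBounds`). This gives the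
single factor `exp (β B̃ n)`.

It remains to integrate over trees. Rooting a tree encodes it by a parent map, and Prüfer codes
bound the number of such maps by `n ^ (n - 2)` (`card_parentMaps_le`). Integrating leaves first, by
translation invariance each nonroot vertex contributes at most `C̃(β)` and the root contributes
`|Λ|` (`lintegral_prod_parentMap`). The coefficient bound follows; `n ^ n / n! ≤ exp n` then yields
a geometric majorant independent of `Λ`. -/

/-- The graph with edges `{p.1, p.2}`, `p ∈ A`. -/
def pairGraph (A : Finset (V × V)) : SimpleGraph V :=
  fromEdgeSet ((fun p => s(p.1, p.2)) '' (A : Set (V × V)))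

theorem pairGraph_adj {A : Finset (V × V)} {i j : V} :
    (pairGraph A).Adj i j ↔ ((i, j) ∈ A ∨ (j, i) ∈ A) ∧ i ≠ j := by
  simp only [pairGraph, fromEdgeSet_adj, Set.mem_image, Finset.mem_coe, Prod.exists, Sym2.eq_iff]
  refine and_congr_left fun _ => ⟨?_, ?_⟩
  · rintro ⟨a, b, h, ⟨rfl, rfl⟩ | ⟨rfl, rfl⟩⟩ <;> simp [h]
  · rintro (h | h)
    · exact ⟨_, _, h, by simp⟩
    · exact ⟨_, _, h, by simp⟩

theorem pairGraph_insert [DecidableEq V] (e : V × V) (A : Finset (V × V)) :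
    pairGraph (insert e A) = edge e.1 e.2 ⊔ pairGraph A := by
  rw [pairGraph, Finset.coe_insert, Set.image_insert_eq, Set.insert_eq, fromEdgeSet_union]
  rfl

open Classical in
/-- The sum of `∏_{p ∈ A} f p` over the sets of pairs `A ⊆ E` such that adding the edges in `A` to
`H` gives a graph with the property `Q`. -/
noncomputable def spanSum (Q : SimpleGraph V → Prop) (f : V × V → ℝ) (E : Finset (V × V))
    (H : SimpleGraph V) : ℝ :=
  ∑ A ∈ E.powerset, if Q (H ⊔ pairGraph A) then ∏ p ∈ A, f p else 0

/-- The deletion-contraction step: split the subsets according to whether they contain `e`. An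
accepted edge is moved into `H`, which is why a general initial graph is carried along. -/
theorem spanSum_insert [DecidableEq V] (Q : SimpleGraph V → Prop) (f : V × V → ℝ)
    {E : Finset (V × V)} {e : V × V} (he : e ∉ E) (H : SimpleGraph V) :
    spanSum Q f (insert e E) H = spanSum Q f E H + f e * spanSum Q f E (H ⊔ edge e.1 e.2) := by
  classical
  rw [spanSum, Finset.sum_powerset_insert he, spanSum, spanSum, Finset.mul_sum]
  congr 1
  refine Finset.sum_congr rfl fun A hA => ?_
  have heA : e ∉ A := fun h => he (Finset.mem_powerset.1 hA h)
  rw [pairGraph_insert, ← sup_assoc, Finset.prod_insert heA, mul_ite, mul_zero]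

theorem spanSum_nonneg {Q : SimpleGraph V → Prop} {f : V × V → ℝ} {E : Finset (V × V)}
    (hf : ∀ p ∈ E, 0 ≤ f p) (H : SimpleGraph V) : 0 ≤ spanSum Q f E H := by
  refine Finset.sum_nonneg fun A hA => ?_
  split_ifs
  · exact Finset.prod_nonneg fun p hp => hf p (Finset.mem_powerset.1 hA hp)
  · exact le_rfl

theorem reachable_of_forall_adj {G G' : SimpleGraph V} (h : ∀ u v, G.Adj u v → G'.Reachable u v)
    {u v : V} (huv : G.Reachable u v) : G'.Reachable u v := by
  obtain ⟨w⟩ := huv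
  induction w with
  | nil => exact .refl _
  | cons hadj _ ih => exact (h _ _ hadj).trans ih

theorem spanSum_connected_sup_edge {f : V × V → ℝ} {E : Finset (V × V)} {H : SimpleGraph V}
    {i j : V} (hij : H.Reachable i j) :
    spanSum Connected f E (H ⊔ edge i j) = spanSum Connected f E H := by
  classical
  refine Finset.sum_congr rfl fun A _ => ?_
  congr 1
  rw [eq_iff_iff]
  constructor
  · intro h
    have := h.nonempty
    refine ⟨fun u v => reachable_of_forall_adj (fun a b hab => ?_) (h.preconnected u v)⟩
    rcases hab with (hab | hab) | hab
    · exact (Adj.reachable hab).mono le_sup_left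
    · rw [edge_adj] at hab
      rcases hab.1 with ⟨rfl, rfl⟩ | ⟨rfl, rfl⟩
      · exact hij.mono le_sup_left
      · exact hij.symm.mono le_sup_left
    · exact (Adj.reachable hab).mono le_sup_right
  · exact fun h => h.mono (sup_le_sup_right le_sup_left _)

open Classical in
/-- The sum of `u` over the pairs of `E` whose members are connected in `H`. -/
noncomputable def innerSum (u : V × V → ℝ) (E : Finset (V × V)) (H : SimpleGraph V) : ℝ :=
  ∑ p ∈ E with H.Reachable p.1 p.2, u p

theorem innerSum_insert_of_reachable [DecidableEq V] (u : V × V → ℝ) {E : Finset (V × V)}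
    {e : V × V} (he : e ∉ E) {H : SimpleGraph V} (hH : H.Reachable e.1 e.2) :
    innerSum u (insert e E) H = u e + innerSum u E H := by
  classical
  rw [innerSum, Finset.filter_insert, if_pos hH, Finset.sum_insert (by simp [he]), innerSum]

theorem innerSum_insert_of_not_reachable [DecidableEq V] (u : V × V → ℝ) {E : Finset (V × V)}
    {e : V × V} {H : SimpleGraph V} (hH : ¬ H.Reachable e.1 e.2) :
    innerSum u (insert e E) H = innerSum u E H := by
  classical
  rw [innerSum, Finset.filter_insert, if_neg hH, innerSum]

theorem innerSum_mono {u : V × V → ℝ} {E : Finset (V × V)} (hu : ∀ p ∈ E, 0 ≤ u p)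
    {H H' : SimpleGraph V} (h : H ≤ H') : innerSum u E H ≤ innerSum u E H' := by
  classical
  refine Finset.sum_le_sum_of_subset_of_nonneg ?_ fun p hp _ => hu p (Finset.mem_filter.1 hp).1
  exact Finset.monotone_filter_right _ fun p _ hp => hp.mono h

theorem innerSum_anti {u : V × V → ℝ} {E : Finset (V × V)} (hu : ∀ p ∈ E, u p ≤ 0)
    {H H' : SimpleGraph V} (h : H ≤ H') : innerSum u E H' ≤ innerSum u E H := by
  have := innerSum_mono (u := fun p => -u p) (E := E) (fun p hp => by simpa using hu p hp) h
  simpa [innerSum] using this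

theorem isAcyclic_sup_edge {H : SimpleGraph V} (hH : H.IsAcyclic) {i j : V}
    (hij : ¬ H.Reachable i j) : (H ⊔ edge i j).IsAcyclic :=
  (isAcyclic_add_edge_iff_of_not_reachable i j hij).2 hH

theorem spanSum_empty_le (f F : V × V → ℝ) {H : SimpleGraph V} (hH : H.IsAcyclic) :
    |spanSum Connected f ∅ H| ≤ spanSum IsTree F ∅ H := by
  classical
  have h0 : pairGraph (∅ : Finset (V × V)) = ⊥ := by simp [pairGraph]
  simp only [spanSum, Finset.powerset_empty, Finset.sum_singleton, Finset.prod_empty, h0,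
    sup_bot_eq]
  by_cases h : H.Connected
  · rw [if_pos h, if_pos ⟨h, hH⟩, abs_one]
  · rw [if_neg h, if_neg fun h' => h h'.1, abs_zero]

/-- Tree-graph bound for pairs of non-negative energy. -/
theorem abs_spanSum_le_of_nonneg {f F u : V × V → ℝ} {E : Finset (V × V)}
    (hF : ∀ p ∈ E, 0 ≤ F p) (hu : ∀ p ∈ E, 0 ≤ u p) (hf : ∀ p ∈ E, |1 + f p| ≤ Real.exp (-u p))
    (hfF : ∀ p ∈ E, |f p| ≤ F p) :
    ∀ {H : SimpleGraph V}, H.IsAcyclic →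
      |spanSum Connected f E H| ≤ Real.exp (-innerSum u E H) * spanSum IsTree F E H := by
  classical
  induction E using Finset.induction_on with
  | empty =>
    intro H hH
    simpa [innerSum] using spanSum_empty_le f F hH
  | insert e E he ih =>
    intro H hH
    simp only [Finset.forall_mem_insert] at hF hu hf hfF
    have ih' := fun {H : SimpleGraph V} => @ih hF.2 hu.2 hf.2 hfF.2 H
    have hT : ∀ H, 0 ≤ spanSum IsTree F E H := spanSum_nonneg hF.2
    rw [spanSum_insert _ _ he, spanSum_insert _ _ he]
    by_cases hr : H.Reachable e.1 e.2
    · rw [spanSum_connected_sup_edge hr, innerSum_insert_of_reachable u he hr,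
        neg_add, Real.exp_add, ← one_add_mul, abs_mul]
      calc |1 + f e| * |spanSum Connected f E H|
          ≤ Real.exp (-u e) * (Real.exp (-innerSum u E H) * spanSum IsTree F E H) :=
            mul_le_mul hf.1 (ih' hH) (abs_nonneg _) (Real.exp_nonneg _)
        _ = Real.exp (-u e) * Real.exp (-innerSum u E H) * (spanSum IsTree F E H + 0) := by ring
        _ ≤ _ := by
            gcongr
            exact mul_nonneg hF.1 (hT _)
    · rw [innerSum_insert_of_not_reachable u hr, mul_add]
      refine (abs_add_le _ _).trans (add_le_add (ih' hH) ?_)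
      rw [abs_mul]
      -- Enlarging the forest only adds non-negative internal energy, so the smaller Boltzmann
      -- factor can be relaxed to the one for `H`.
      have hmono : innerSum u E H ≤ innerSum u E (H ⊔ edge e.1 e.2) :=
        innerSum_mono hu.2 le_sup_left
      calc |f e| * |spanSum Connected f E (H ⊔ edge e.1 e.2)|
          ≤ F e * (Real.exp (-innerSum u E H) * spanSum IsTree F E (H ⊔ edge e.1 e.2)) := by
            refine mul_le_mul hfF.1 ((ih' (isAcyclic_sup_edge hH hr)).trans ?_) (abs_nonneg _) hF.1
            have := hT (H ⊔ edge e.1 e.2)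
            gcongr
        _ = _ := by ring

/-- Tree-graph bound after the pairs of non-negative energy have been treated. The pairs in `M` are
those of negative energy that have been decided already. -/
theorem abs_spanSum_union_le [DecidableEq V] {f F u : V × V → ℝ} {P N : Finset (V × V)} {K : ℝ}
    (hFP : ∀ p ∈ P, 0 ≤ F p) (huP : ∀ p ∈ P, 0 ≤ u p)
    (hfP : ∀ p ∈ P, |1 + f p| ≤ Real.exp (-u p)) (hfFP : ∀ p ∈ P, |f p| ≤ F p)
    (hF : ∀ p ∈ N, 0 ≤ F p) (hu : ∀ p ∈ N, u p ≤ 0)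
    (hf : ∀ p ∈ N, |1 + f p| ≤ Real.exp (-u p))
    (hfF : ∀ p ∈ N, |f p| ≤ Real.exp (-u p) * F p) (hPN : Disjoint P N) :
    ∀ {M : Finset (V × V)}, Disjoint N M → (∀ p ∈ M, u p ≤ 0) →
      (∀ H, -K ≤ innerSum u P H + innerSum u (N ∪ M) H) →
      ∀ {H : SimpleGraph V}, H.IsAcyclic → |spanSum Connected f (N ∪ P) H| ≤
        Real.exp (K + innerSum u M H) * spanSum IsTree F (N ∪ P) H := by
  induction N using Finset.induction_on with
  | empty =>
    intro M _ _ hK H hH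
    simp only [Finset.empty_union] at hK ⊢
    -- All negative pairs are now in `M`, so stability reads `-innerSum u P H ≤ K + innerSum u M H`,
    -- which is the exponent required.
    refine (abs_spanSum_le_of_nonneg hFP huP hfP hfFP hH).trans ?_
    have := spanSum_nonneg (Q := IsTree) hFP H
    gcongr
    linarith [hK H]
  | insert e N he ih =>
    intro M hM huM hK H hH
    simp only [Finset.forall_mem_insert] at hF hu hf hfF
    rw [Finset.disjoint_insert_left] at hM
    rw [Finset.disjoint_insert_right] at hPN
    have heU : e ∉ N ∪ P := by simp [he, hPN.1]
    have ih' : ∀ {H : SimpleGraph V}, H.IsAcyclic → |spanSum Connected f (N ∪ P) H| ≤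
        Real.exp (K + innerSum u (insert e M) H) * spanSum IsTree F (N ∪ P) H := by
      refine ih hF.2 hu.2 hf.2 hfF.2 hPN.2 (M := insert e M) ?_ ?_ ?_
      · rw [Finset.disjoint_insert_right]
        exact ⟨he, hM.2⟩
      · simpa only [Finset.forall_mem_insert] using ⟨hu.1, huM⟩
      · simpa only [Finset.union_insert, Finset.insert_union] using hK
    have hT : ∀ H, 0 ≤ spanSum IsTree F (N ∪ P) H := spanSum_nonneg fun p hp =>
      (Finset.mem_union.1 hp).elim (hF.2 p) (hFP p)
    rw [Finset.insert_union, spanSum_insert _ _ heU, spanSum_insert _ _ heU]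
    by_cases hr : H.Reachable e.1 e.2
    · have h1 := ih' hH
      rw [innerSum_insert_of_reachable u hM.1 hr] at h1
      rw [spanSum_connected_sup_edge hr, ← one_add_mul, abs_mul]
      -- The factor `exp (-u e)` cancels exactly the energy `u e` that `e` contributes on joining
      -- `M`.
      calc |1 + f e| * |spanSum Connected f (N ∪ P) H|
          ≤ Real.exp (-u e) * (Real.exp (K + (u e + innerSum u M H)) *
              spanSum IsTree F (N ∪ P) H) :=
            mul_le_mul hf.1 h1 (abs_nonneg _) (Real.exp_nonneg _)
        _ = Real.exp (K + innerSum u M H) * (spanSum IsTree F (N ∪ P) H + 0) := by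
            rw [← mul_assoc, ← Real.exp_add, add_zero]
            ring_nf
        _ ≤ _ := by
            gcongr
            exact mul_nonneg hF.1 (hT _)
    · rw [mul_add]
      refine (abs_add_le _ _).trans (add_le_add ?_ ?_)
      · simpa only [innerSum_insert_of_not_reachable u hr] using ih' hH
      rw [abs_mul]
      -- After `e` is accepted its ends are connected, so `e` counts in the internal energy of
      -- `insert e M`. Its term `u e` pays for the extra `exp (-u e)` in the bound on `|f e|`.
      have hr' : (H ⊔ edge e.1 e.2).Reachable e.1 e.2 := by
        refine Adj.reachable (Or.inr ?_)
        rw [edge_adj]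
        exact ⟨Or.inl ⟨rfl, rfl⟩, fun h => hr (h ▸ Reachable.refl _)⟩
      have h1 := ih' (isAcyclic_sup_edge hH hr)
      rw [innerSum_insert_of_reachable u hM.1 hr'] at h1
      have hmono : innerSum u M (H ⊔ edge e.1 e.2) ≤ innerSum u M H :=
        innerSum_anti huM le_sup_left
      have := hT (H ⊔ edge e.1 e.2)
      calc |f e| * |spanSum Connected f (N ∪ P) (H ⊔ edge e.1 e.2)|
          ≤ Real.exp (-u e) * F e * (Real.exp (K + (u e + innerSum u M H)) *
              spanSum IsTree F (N ∪ P) (H ⊔ edge e.1 e.2)) := by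
            refine mul_le_mul hfF.1 (h1.trans ?_) (abs_nonneg _)
              (mul_nonneg (Real.exp_nonneg _) hF.1)
            gcongr
        _ = (Real.exp (-u e) * Real.exp (K + (u e + innerSum u M H))) * (F e *
              spanSum IsTree F (N ∪ P) (H ⊔ edge e.1 e.2)) := by ring
        _ = _ := by
            rw [← Real.exp_add]
            ring_nf

/-- Tree-graph bound: if the energy `u` is stable with constant `K` on every partition into
connected components, the sum over connected graphs is at most `e ^ K` times a sum over trees. -/
theorem abs_spanSum_connected_le {f F u : V × V → ℝ} {E : Finset (V × V)} {K : ℝ}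
    (hF : ∀ p ∈ E, 0 ≤ F p) (hf : ∀ p ∈ E, |1 + f p| ≤ Real.exp (-u p))
    (hfF : ∀ p ∈ E, |f p| ≤ Real.exp (-min (u p) 0) * F p)
    (hK : ∀ H, -K ≤ innerSum u E H) :
    |spanSum Connected f E ⊥| ≤ Real.exp K * spanSum IsTree F E ⊥ := by
  classical
  have hdisj : Disjoint (E.filter fun p => 0 ≤ u p) (E.filter fun p => ¬ 0 ≤ u p) :=
    Finset.disjoint_filter_filter_not _ _ _
  have hU : (E.filter fun p => ¬ 0 ≤ u p) ∪ (E.filter fun p => 0 ≤ u p) = E := by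
    rw [Finset.union_comm, Finset.filter_union_filter_not_eq]
  -- With no pair decided and no edge present, the exponent `K + innerSum u ∅ ⊥` is just `K`.
  have key := abs_spanSum_union_le (f := f) (F := F) (u := u) (P := E.filter fun p => 0 ≤ u p)
    (N := E.filter fun p => ¬ 0 ≤ u p) (K := K)
    (fun p hp => hF p (Finset.mem_filter.1 hp).1) (fun p hp => (Finset.mem_filter.1 hp).2)
    (fun p hp => hf p (Finset.mem_filter.1 hp).1)
    (fun p hp => by
      have h := hfF p (Finset.mem_filter.1 hp).1
      rwa [min_eq_right (Finset.mem_filter.1 hp).2, neg_zero, Real.exp_zero, one_mul] at h)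
    (fun p hp => hF p (Finset.mem_filter.1 hp).1)
    (fun p hp => (not_le.1 (Finset.mem_filter.1 hp).2).le)
    (fun p hp => hf p (Finset.mem_filter.1 hp).1)
    (fun p hp => by
      have h := hfF p (Finset.mem_filter.1 hp).1
      rwa [min_eq_left (not_le.1 (Finset.mem_filter.1 hp).2).le] at h)
    hdisj (M := ∅) (Finset.disjoint_empty_right _) (by simp) ?_ (H := ⊥) isAcyclic_bot
  · rw [hU] at key
    simpa [innerSum] using key
  · intro H
    refine (hK H).trans_eq ?_
    rw [Finset.union_empty, innerSum, innerSum, innerSum, ← Finset.sum_union, ← Finset.filter_union,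
      Finset.union_comm, hU]
    exact Finset.disjoint_filter_filter hdisj

open Classical in
/-- A sum over subsets of the pairs `i < j` is a sum over graphs. -/
theorem spanSum_bot_eq_sum_graphs [Fintype V] [LinearOrder V] (Q : SimpleGraph V → Prop)
    (f : V × V → ℝ) :
    spanSum Q f (Finset.univ.filter fun p : V × V => p.1 < p.2) ⊥ =
      ∑ g : SimpleGraph V with Q g, ∏ p : V × V with p.1 < p.2 ∧ g.Adj p.1 p.2, f p := by
  have hinv : ∀ A ∈ (Finset.univ.filter fun p : V × V => p.1 < p.2).powerset,
      (Finset.univ.filter fun p : V × V => p.1 < p.2 ∧ (pairGraph A).Adj p.1 p.2) = A := by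
    intro A hA
    rw [Finset.mem_powerset] at hA
    have hA' : ∀ p ∈ A, p.1 < p.2 := fun p hp => (Finset.mem_filter.1 (hA hp)).2
    ext p
    simp only [Finset.mem_filter, Finset.mem_univ, true_and, pairGraph_adj]
    constructor
    · rintro ⟨hlt, h | h, _⟩
      · exact h
      · exact absurd hlt (hA' _ h).not_gt
    · exact fun hp => ⟨hA' p hp, Or.inl hp, (hA' p hp).ne⟩
  rw [spanSum, Finset.sum_filter]
  refine Finset.sum_nbij' (fun A => pairGraph A)
    (fun g => Finset.univ.filter fun p : V × V => p.1 < p.2 ∧ g.Adj p.1 p.2)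
    (fun _ _ => Finset.mem_univ _) (fun g _ => ?_) hinv (fun g _ => ?_) (fun A hA => ?_)
  · exact Finset.mem_powerset.2 (Finset.monotone_filter_right _ fun p _ h => h.1)
  · ext i j
    simp only [pairGraph_adj, Finset.mem_filter, Finset.mem_univ, true_and]
    constructor
    · rintro ⟨⟨_, h⟩ | ⟨_, h⟩, _⟩
      · exact h
      · exact h.symm
    · intro h
      rcases lt_trichotomy i j with hij | hij | hij
      · exact ⟨Or.inl ⟨hij, h⟩, h.ne⟩
      · exact absurd hij h.ne
      · exact ⟨Or.inr ⟨hij, h.symm⟩, h.ne⟩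
  · rw [bot_sup_eq, hinv A hA]

end SpanningSums

end MayerGas

namespace MayerGas

/-! ### Parent maps and their Prüfer codes -/

section Parents

variable {V : Type*}

/-- `p` is the parent map of a rooted forest on `U`, in the sense that iterating `p` leads out
of `U`. -/
def IsParentMapOn (U : Finset V) (p : V → V) : Prop :=
  ∃ rk : V → ℕ, ∀ v ∈ U, rk (p v) < rk v

theorem IsParentMapOn.mono {U U' : Finset V} {p : V → V} (h : IsParentMapOn U p) (hU : U' ⊆ U) :
    IsParentMapOn U' p := by
  obtain ⟨rk, hrk⟩ := h
  exact ⟨rk, fun v hv => hrk v (hU hv)⟩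

theorem IsParentMapOn.apply_ne {U : Finset V} {p : V → V} (h : IsParentMapOn U p) {v : V}
    (hv : v ∈ U) : p v ≠ v := by
  obtain ⟨rk, hrk⟩ := h
  exact fun hpv => (hrk v hv).ne (by rw [hpv])

theorem IsParentMapOn.exists_leaf [DecidableEq V] {U : Finset V} {p : V → V}
    (h : IsParentMapOn U p) (hU : U.Nonempty) : (U \ U.image p).Nonempty := by
  obtain ⟨rk, hrk⟩ := h
  obtain ⟨v, hv, hmax⟩ := U.exists_max_image rk hU
  refine ⟨v, Finset.mem_sdiff.2 ⟨hv, fun hmem => ?_⟩⟩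
  obtain ⟨w, hw, rfl⟩ := Finset.mem_image.1 hmem
  exact (hrk w hw).not_ge (hmax w hw)

/-- The Prüfer code of a parent map on `U`, with `k` steps: remove the smallest leaf and record its
parent. -/
def prueferCode [LinearOrder V] (p : V → V) : ℕ → Finset V → List V
  | 0, _ => []
  | k + 1, U =>
    if h : (U \ U.image p).Nonempty then
      p ((U \ U.image p).min' h) :: prueferCode p k (U.erase ((U \ U.image p).min' h))
    else []

variable [LinearOrder V]

theorem prueferCode_succ {U : Finset V} {p : V → V} (h : IsParentMapOn U p) {k : ℕ}
    (hk : U.card = k + 1) :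
    ∃ hU : (U \ U.image p).Nonempty,
      (U \ U.image p).min' hU ∈ U \ U.image p ∧
      (U.erase ((U \ U.image p).min' hU)).card = k ∧
      prueferCode p (k + 1) U = p ((U \ U.image p).min' hU) ::
        prueferCode p k (U.erase ((U \ U.image p).min' hU)) := by
  have hU := h.exists_leaf (Finset.card_pos.1 (by omega))
  have hm := Finset.min'_mem _ hU
  refine ⟨hU, hm, ?_, by rw [prueferCode, dif_pos hU]⟩
  rw [Finset.card_erase_of_mem (Finset.mem_sdiff.1 hm).1, hk, Nat.add_sub_cancel]

theorem length_prueferCode {p : V → V} {k : ℕ} : ∀ {U : Finset V}, IsParentMapOn U p →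
    U.card = k → (prueferCode p k U).length = k := by
  induction k with
  | zero => intro U _ _; rfl
  | succ k ih =>
    intro U h hk
    obtain ⟨hU, hm, hc, heq⟩ := prueferCode_succ h hk
    rw [heq, List.length_cons, ih (h.mono (Finset.erase_subset _ _)) hc]

/-- Every vertex of `U` is removed exactly once and its parent recorded, so the code determines
which vertices are leaves. -/
theorem toFinset_prueferCode {p : V → V} {k : ℕ} : ∀ {U : Finset V}, IsParentMapOn U p →
    U.card = k → (prueferCode p k U).toFinset = U.image p := by
  induction k with
  | zero => intro U _ hk; rw [Finset.card_eq_zero.1 hk]; rfl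
  | succ k ih =>
    intro U h hk
    obtain ⟨hU, hm, hc, heq⟩ := prueferCode_succ h hk
    rw [heq, List.toFinset_cons, ih (h.mono (Finset.erase_subset _ _)) hc, ← Finset.image_insert,
      Finset.insert_erase (Finset.mem_sdiff.1 hm).1]

theorem eq_of_prueferCode_eq {p q : V → V} {k : ℕ} : ∀ {U : Finset V}, IsParentMapOn U p →
    IsParentMapOn U q → U.card = k → prueferCode p k U = prueferCode q k U →
    ∀ v ∈ U, p v = q v := by
  induction k with
  | zero => intro U _ _ hk _ v hv; simp [Finset.card_eq_zero.1 hk] at hv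
  | succ k ih =>
    intro U hp hq hk h v hv
    -- Equal codes have the same entries, hence both maps have the same leaves and remove the same
    -- smallest one.
    have himg : U.image p = U.image q := by
      rw [← toFinset_prueferCode hp hk, ← toFinset_prueferCode hq hk, h]
    obtain ⟨hU, hm, hc, heq⟩ := prueferCode_succ hp hk
    obtain ⟨hU', -, -, heq'⟩ := prueferCode_succ hq hk
    rw [heq, heq'] at h
    simp only [← himg] at h
    rw [List.cons.injEq] at h
    by_cases hvm : v = (U \ U.image p).min' hU
    · rw [hvm]
      exact h.1
    · exact ih (hp.mono (Finset.erase_subset _ _)) (hq.mono (Finset.erase_subset _ _)) hc h.2 v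
        (Finset.mem_erase.2 ⟨hvm, hv⟩)

/-- The last surviving vertex cannot be its own parent, so its parent is `r`. -/
theorem exists_prueferCode_eq_append {p : V → V} {r : V} {k : ℕ} : ∀ {U : Finset V},
    IsParentMapOn U p → (∀ v ∈ U, p v ∈ insert r U) → U.card = k + 1 →
    ∃ l, prueferCode p (k + 1) U = l ++ [r] := by
  induction k with
  | zero =>
    intro U h hr hk
    obtain ⟨hU, hm, -, heq⟩ := prueferCode_succ h hk
    have hmU := (Finset.mem_sdiff.1 hm).1
    refine ⟨[], ?_⟩
    rw [heq, prueferCode, List.nil_append, List.cons.injEq]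
    refine ⟨?_, rfl⟩
    rcases Finset.mem_insert.1 (hr _ hmU) with h' | h'
    · exact h'
    · exact absurd (Finset.card_le_one.1 hk.le _ h' _ hmU) (h.apply_ne hmU)
  | succ k ih =>
    intro U h hr hk
    obtain ⟨hU, hm, hc, heq⟩ := prueferCode_succ h hk
    have hr' : ∀ v ∈ U.erase ((U \ U.image p).min' hU),
        p v ∈ insert r (U.erase ((U \ U.image p).min' hU)) := by
      intro v hv
      have hvU := Finset.mem_of_mem_erase hv
      rcases Finset.mem_insert.1 (hr v hvU) with h' | h'
      · exact Finset.mem_insert.2 (Or.inl h')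
      -- The removed vertex is a leaf, hence nobody's parent, and the remaining set is still closed
      -- under parents up to `r`.
      · refine Finset.mem_insert_of_mem (Finset.mem_erase.2 ⟨fun h'' => ?_, h'⟩)
        exact (Finset.mem_sdiff.1 hm).2 (h'' ▸ Finset.mem_image_of_mem p hvU)
    obtain ⟨l, hl⟩ := ih (h.mono (Finset.erase_subset _ _)) hr' hc
    exact ⟨p ((U \ U.image p).min' hU) :: l, by rw [heq, hl, List.cons_append]⟩

variable [Fintype V]

open Classical in
/-- The parent maps of the trees on `V` rooted at `r`, extended by `r ↦ r`. -/
noncomputable def parentMaps (r : V) : Finset (V → V) :=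
  Finset.univ.filter fun p => p r = r ∧ IsParentMapOn (Finset.univ.erase r) p

theorem mem_parentMaps {r : V} {p : V → V} :
    p ∈ parentMaps r ↔ p r = r ∧ IsParentMapOn (Finset.univ.erase r) p := by
  simp [parentMaps]

/-- The code has `n - 1` entries and the last is always `r`, so the other `n - 2` determine the map.
For `n = 1` truncated subtraction gives the correct bound `1`. -/
theorem card_parentMaps_le (r : V) :
    (parentMaps r).card ≤ Fintype.card V ^ (Fintype.card V - 2) := by
  classical
  have hU : (Finset.univ.erase r : Finset V).card = Fintype.card V - 1 := by
    rw [Finset.card_erase_of_mem (Finset.mem_univ r), Finset.card_univ]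
  have hlen : ∀ p ∈ parentMaps r,
      (prueferCode p (Fintype.card V - 1) (Finset.univ.erase r)).dropLast.length =
        Fintype.card V - 2 := by
    intro p hp
    rw [List.length_dropLast, length_prueferCode (mem_parentMaps.1 hp).2 hU]
    omega
  rw [← card_vector, ← Fintype.card_coe]
  refine Fintype.card_le_of_injective
    (fun p : parentMaps r => (⟨_, hlen p p.2⟩ : List.Vector V _)) ?_
  rintro ⟨p, hp⟩ ⟨q, hq⟩ hpq
  replace hpq : (prueferCode p (Fintype.card V - 1) (Finset.univ.erase r)).dropLast =
    (prueferCode q (Fintype.card V - 1) (Finset.univ.erase r)).dropLast := congrArg Subtype.val hpq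
  rw [Subtype.mk.injEq]
  have hp' := mem_parentMaps.1 hp
  have hq' := mem_parentMaps.1 hq
  have hcode : prueferCode p (Fintype.card V - 1) (Finset.univ.erase r) =
      prueferCode q (Fintype.card V - 1) (Finset.univ.erase r) := by
    rcases hn : Fintype.card V - 1 with _ | k
    · rfl
    · rw [hn] at hpq hU
      have hins : ∀ v : V, v ∈ insert r (Finset.univ.erase r) := fun v => by
        rw [Finset.insert_erase (Finset.mem_univ r)]
        exact Finset.mem_univ v
      obtain ⟨l, hl⟩ := exists_prueferCode_eq_append hp'.2 (fun v _ => hins (p v)) hU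
      obtain ⟨l', hl'⟩ := exists_prueferCode_eq_append hq'.2 (fun v _ => hins (q v)) hU
      rw [hl, hl', List.dropLast_concat, List.dropLast_concat] at hpq
      rw [hl, hl', hpq]
  funext v
  by_cases hv : v = r
  · rw [hv, hp'.1, hq'.1]
  · exact eq_of_prueferCode_eq hp'.2 hq'.2 hU hcode v
      (Finset.mem_erase.2 ⟨hv, Finset.mem_univ v⟩)

end Parents

/-! ### From trees to parent maps -/

section Trees

open SimpleGraph

variable {V : Type*}

theorem exists_adj_dist_lt {g : SimpleGraph V} (hg : g.Connected) {r v : V} (hv : v ≠ r) :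
    ∃ w, g.Adj v w ∧ g.dist w r < g.dist v r := by
  obtain ⟨w, hw⟩ := hg.exists_walk_length_eq_dist v r
  cases w with
  | nil => exact absurd rfl hv
  | cons h w' =>
    refine ⟨_, h, (dist_le w').trans_lt ?_⟩
    rw [← hw, Walk.length_cons]
    exact Nat.lt_succ_self _

open Classical in
/-- The neighbour of `v` on a shortest path to `r`. -/
noncomputable def treeParent (g : SimpleGraph V) (r v : V) : V :=
  if h : v ≠ r ∧ g.Connected then (exists_adj_dist_lt h.2 h.1).choose else r

theorem treeParent_self (g : SimpleGraph V) (r : V) : treeParent g r r = r := by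
  rw [treeParent, dif_neg (by simp)]

theorem treeParent_spec {g : SimpleGraph V} (hg : g.Connected) {r v : V} (hv : v ≠ r) :
    g.Adj v (treeParent g r v) ∧ g.dist (treeParent g r v) r < g.dist v r := by
  rw [treeParent, dif_pos ⟨hv, hg⟩]
  exact (exists_adj_dist_lt hg hv).choose_spec

/-- If two vertices gave the same edge with its ends swapped, each would be the parent of the other
and strictly closer to `r`. -/
theorem injOn_mk_treeParent {g : SimpleGraph V} (hg : g.Connected) (r : V) :
    Set.InjOn (fun v => s(v, treeParent g r v)) {v | v ≠ r} := by
  intro v hv w hw h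
  rcases Sym2.eq_iff.1 h with h | h
  · exact h.1
  · have h1 := (treeParent_spec hg hv).2
    have h2 := (treeParent_spec hg hw).2
    rw [h.2] at h1
    rw [← h.1] at h2
    exact absurd h1 h2.not_gt

variable [Fintype V] [LinearOrder V]

/-- The edges to parents are distinct and as many as the edges of a tree, so they exhaust it. In
particular a tree is recovered from its parent map. -/
theorem image_mk_treeParent {g : SimpleGraph V} [Fintype g.edgeSet] (hg : g.IsTree) (r : V) :
    (Finset.univ.erase r).image (fun v => s(v, treeParent g r v)) = g.edgeFinset := by
  have hinj : Set.InjOn (fun v => s(v, treeParent g r v)) (Finset.univ.erase r : Finset V) :=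
    fun v hv w hw h => injOn_mk_treeParent hg.1 r (by simpa using hv) (by simpa using hw) h
  refine Finset.eq_of_subset_of_card_le ?_ ?_
  · intro e he
    obtain ⟨v, hv, rfl⟩ := Finset.mem_image.1 he
    rw [mem_edgeFinset, mem_edgeSet]
    exact (treeParent_spec hg.1 (Finset.ne_of_mem_erase hv)).1
  · rw [Finset.card_image_of_injOn hinj, Finset.card_erase_of_mem (Finset.mem_univ r),
      Finset.card_univ, ← hg.card_edgeFinset, Nat.add_sub_cancel]

open Classical in
theorem prod_pairs_eq_prod_treeParent {g : SimpleGraph V} (hg : g.IsTree) (r : V)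
    {F : V × V → ℝ} (hF : ∀ i j, F (i, j) = F (j, i)) :
    ∏ p : V × V with p.1 < p.2 ∧ g.Adj p.1 p.2, F p =
      ∏ v ∈ Finset.univ.erase r, F (v, treeParent g r v) := by
  let F' : Sym2 V → ℝ := Sym2.lift ⟨fun i j => F (i, j), hF⟩
  have h1 : ∏ p : V × V with p.1 < p.2 ∧ g.Adj p.1 p.2, F p = ∏ e ∈ g.edgeFinset, F' e := by
    refine Finset.prod_nbij (fun p => s(p.1, p.2)) ?_ ?_ ?_ fun p _ => rfl
    · intro p hp
      simpa using (Finset.mem_filter.1 hp).2.2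
    · intro p hp q hq h
      have hp' := (Finset.mem_filter.1 hp).2.1
      have hq' := (Finset.mem_filter.1 hq).2.1
      rcases Sym2.eq_iff.1 h with h | h
      · exact Prod.ext h.1 h.2
      · rw [h.1, h.2] at hp'
        exact absurd hp' hq'.not_gt
    · intro e he
      induction e using Sym2.ind with
      | _ i j =>
        have hadj : g.Adj i j := by simpa using he
        rcases lt_or_gt_of_ne hadj.ne with hij | hij
        · exact ⟨(i, j), by simp [hij, hadj], rfl⟩
        · exact ⟨(j, i), by simp [hij, hadj.symm], Sym2.eq_swap⟩
  rw [h1, ← image_mk_treeParent hg r, Finset.prod_image]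
  · rfl
  · exact fun v hv w hw h => injOn_mk_treeParent hg.1 r (by simpa using hv) (by simpa using hw) h

/-- A sum over trees is at most the sum over parent maps. -/
theorem spanSum_isTree_le_sum_parentMaps (r : V) {F : V × V → ℝ} (hF0 : ∀ p, 0 ≤ F p)
    (hF : ∀ i j, F (i, j) = F (j, i)) :
    spanSum IsTree F (Finset.univ.filter fun p : V × V => p.1 < p.2) ⊥ ≤
      ∑ p ∈ parentMaps r, ∏ v ∈ Finset.univ.erase r, F (v, p v) := by
  classical
  rw [spanSum_bot_eq_sum_graphs]
  have hinj : Set.InjOn (fun g => treeParent g r)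
      ((Finset.univ.filter fun g : SimpleGraph V => g.IsTree : Finset _) : Set _) := by
    intro g hg g' hg' h
    have hg := (Finset.mem_filter.1 hg).2
    have hg' := (Finset.mem_filter.1 hg').2
    have hE : g.edgeFinset = g'.edgeFinset := by
      rw [← image_mk_treeParent hg r, ← image_mk_treeParent hg' r]
      simp only at h
      rw [h]
    exact edgeFinset_inj.1 hE
  rw [Finset.sum_congr rfl fun g hg =>
    prod_pairs_eq_prod_treeParent (Finset.mem_filter.1 hg).2 r hF,
    ← Finset.sum_image (f := fun p => ∏ v ∈ Finset.univ.erase r, F (v, p v)) hinj]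
  refine Finset.sum_le_sum_of_subset_of_nonneg ?_ fun p _ _ => Finset.prod_nonneg fun _ _ => hF0 _
  intro p hp
  obtain ⟨g, hg, rfl⟩ := Finset.mem_image.1 hp
  have hg := (Finset.mem_filter.1 hg).2
  exact mem_parentMaps.2 ⟨treeParent_self g r, fun v => g.dist v r, fun v hv =>
    (treeParent_spec hg.1 (Finset.ne_of_mem_erase hv)).2⟩

end Trees

end MayerGas

namespace MayerGas

/-! ### Boltzmann factors and the bound on one edge -/

section Boltzmann

theorem boltzmann_coe (β t : ℝ) : boltzmann β (t : EReal) = Real.exp (-(β * t)) := by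
  rw [boltzmann, ← EReal.coe_mul, ← EReal.coe_neg, EReal.exp_coe,
    ENNReal.toReal_ofReal (Real.exp_nonneg _)]

theorem boltzmann_top {β : ℝ} (hβ : 0 < β) : boltzmann β ⊤ = 0 := by
  rw [boltzmann, EReal.coe_mul_top_of_pos hβ, EReal.neg_top, EReal.exp_bot, ENNReal.toReal_zero]

theorem boltzmann_nonneg (β : ℝ) (v : EReal) : 0 ≤ boltzmann β v := ENNReal.toReal_nonneg

theorem boltzmann_add_coe {β : ℝ} (hβ : 0 < β) {v : EReal} (hv : v ≠ ⊥) (t : ℝ) :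
    boltzmann β (v + t) = boltzmann β v * Real.exp (-(β * t)) := by
  induction v with
  | bot => exact absurd rfl hv
  | coe s =>
    rw [← EReal.coe_add, boltzmann_coe, boltzmann_coe, ← Real.exp_add]
    ring_nf
  | top => rw [EReal.top_add_coe, boltzmann_top hβ, zero_mul]

theorem boltzmann_le_one {β : ℝ} (hβ : 0 < β) {v : EReal} (hv : 0 ≤ v) : boltzmann β v ≤ 1 := by
  induction v with
  | bot => simp at hv
  | coe s =>
    rw [boltzmann_coe, Real.exp_le_one_iff, neg_nonpos]
    exact mul_nonneg hβ.le (EReal.coe_nonneg.1 hv)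
  | top => rw [boltzmann_top hβ]; exact zero_le_one

theorem abs_boltzmann_sub_one_le_one {β : ℝ} (hβ : 0 < β) {v : EReal} (hv : 0 ≤ v) :
    |boltzmann β v - 1| ≤ 1 := by
  rw [abs_le]
  constructor <;> linarith [boltzmann_nonneg β v, boltzmann_le_one hβ hv]

theorem ofReal_abs_boltzmann_sub_one_le {β : ℝ} (hβ : 0 < β) {v : EReal} (hv : 0 ≤ v) :
    ENNReal.ofReal |boltzmann β v - 1| ≤ ENNReal.ofReal β * v.abs := by
  induction v with
  | bot => simp at hv
  | coe s =>
    have hs := EReal.coe_nonneg.1 hv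
    rw [EReal.abs_def, ← ENNReal.ofReal_mul hβ.le, boltzmann_coe, abs_of_nonneg hs, abs_sub_comm,
      abs_of_nonneg (by simpa using mul_nonneg hβ.le hs)]
    exact ENNReal.ofReal_le_ofReal (by linarith [Real.add_one_le_exp (-(β * s))])
  | top =>
    rw [EReal.abs_top, ENNReal.mul_top (by simpa using hβ)]
    exact le_top

theorem measurable_boltzmann (β : ℝ) : Measurable (boltzmann β) := by
  have h : Measurable fun v : EReal => -((β : EReal) * v) :=
    continuous_neg.measurable.comp (measurable_const.mul measurable_id)
  exact h.ereal_exp.ennreal_toReal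

/-- For `u ≥ 0`, write `1 - b e^{-u} = (1 - b) + b (1 - e^{-u})`. For `u ≤ 0`, take out `e^{-u}` and
compare `b` with `e^u` through `1`. The value `b = 0` covers a hard core. -/
theorem abs_mul_exp_sub_one_le {b : ℝ} (hb0 : 0 ≤ b) (hb1 : b ≤ 1) (u : ℝ) :
    |b * Real.exp (-u) - 1| ≤ Real.exp (-min u 0) * (|b - 1| + |u|) := by
  have hb : |b - 1| = 1 - b := by rw [abs_sub_comm, abs_of_nonneg (by linarith)]
  have h1 := Real.add_one_le_exp (-u)
  have h2 := Real.add_one_le_exp u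
  have hpos := Real.exp_pos (-u)
  rcases le_total 0 u with hu | hu
  · have h3 : Real.exp (-u) ≤ 1 := Real.exp_le_one_iff.2 (by linarith)
    rw [min_eq_right hu, neg_zero, Real.exp_zero, one_mul, hb, abs_of_nonneg hu, abs_le]
    constructor <;> nlinarith
  · have h4 : Real.exp (-u) * Real.exp u = 1 := by rw [← Real.exp_add]; simp
    have h5 : 1 ≤ Real.exp (-u) := Real.one_le_exp (by linarith)
    rw [min_eq_left hu, hb, abs_of_nonpos hu, abs_le]
    constructor <;> nlinarith

end Boltzmann

/-! ### Stability on every partition into clusters -/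

section Stability

variable {d : ℕ}

/-- For a fixed configuration the condition on `B` is a closed half-line, so it passes to the
infimum. -/
theorem stabilityConst_mem {Φ : ℝ≥0 → EReal} (h : IsStable d Φ) :
    stabilityConst d Φ ∈ stabilityBounds d Φ := by
  have hne : (stabilityBounds d Φ).Nonempty := h
  refine ⟨le_csInf hne fun B hB => hB.1, fun N x => ?_⟩
  rcases N.eq_zero_or_pos with rfl | hN
  · simp [energy]
  have hN' : (0 : ℝ) < N := Nat.cast_pos.2 hN
  obtain ⟨B₀, hB₀⟩ := hne
  have key : ∀ e : EReal, (∀ B ∈ stabilityBounds d Φ, ((-(B * N) : ℝ) : EReal) ≤ e) →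
      ((-(stabilityConst d Φ * N) : ℝ) : EReal) ≤ e := by
    intro e he
    induction e with
    | bot => exact absurd (he B₀ hB₀) (not_le.2 (EReal.bot_lt_coe _))
    | coe e =>
      rw [EReal.coe_le_coe_iff]
      have : -e / N ≤ stabilityConst d Φ := le_csInf ⟨B₀, hB₀⟩ fun B hB => by
        have := EReal.coe_le_coe_iff.1 (he B hB)
        rw [div_le_iff₀ hN']
        linarith
      rw [div_le_iff₀ hN'] at this
      linarith
    | top => exact le_top
  exact key _ fun B hB => hB.2 N x

theorem sum_sum_Ioi_eq {N : ℕ} {M : Type*} [AddCommMonoid M] (g : Fin N × Fin N → M) :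
    ∑ i, ∑ j ∈ Finset.Ioi i, g (i, j) = ∑ p : Fin N × Fin N with p.1 < p.2, g p := by
  rw [Finset.sum_filter, Fintype.sum_prod_type]
  refine Finset.sum_congr rfl fun i _ => ?_
  rw [← Finset.sum_filter]
  refine Finset.sum_congr ?_ fun _ _ => rfl
  ext j
  simp

theorem coe_sum_eq {ι : Type*} (s : Finset ι) (f : ι → ℝ) :
    ((∑ i ∈ s, f i : ℝ) : EReal) = ∑ i ∈ s, (f i : EReal) :=
  map_sum (⟨⟨Real.toEReal, EReal.coe_zero⟩, EReal.coe_add⟩ : ℝ →+ EReal) f s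

/-- Stability applied to the subconfiguration indexed by `s`; listing `s` in increasing order
preserves the convention `i < j`. -/
theorem neg_le_sum_pairs_of_mem_stabilityBounds {Φ : ℝ≥0 → EReal} {B : ℝ}
    (hB : B ∈ stabilityBounds d Φ) {n : ℕ} {x : Fin n → EuclideanSpace ℝ (Fin d)}
    {w : Fin n × Fin n → ℝ} (hw : ∀ p : Fin n × Fin n, p.1 < p.2 → Φ ‖x p.1 - x p.2‖₊ = w p)
    (s : Finset (Fin n)) :
    -(B * s.card) ≤ ∑ p : Fin n × Fin n with p.1 < p.2 ∧ p.1 ∈ s ∧ p.2 ∈ s, w p := by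
  have h := hB.2 s.card fun i => x (s.orderEmbOfFin rfl i)
  rw [energy, sum_sum_Ioi_eq (fun p : Fin s.card × Fin s.card =>
    Φ ‖x (s.orderEmbOfFin rfl p.1) - x (s.orderEmbOfFin rfl p.2)‖₊),
    Finset.sum_congr rfl fun p hp => hw (s.orderEmbOfFin rfl p.1, s.orderEmbOfFin rfl p.2)
      ((s.orderEmbOfFin rfl).strictMono (Finset.mem_filter.1 hp).2)] at h
  rw [← EReal.coe_le_coe_iff]
  refine h.trans_eq ?_
  rw [← coe_sum_eq]
  congr 1
  refine Finset.sum_nbij (fun p => (s.orderEmbOfFin rfl p.1, s.orderEmbOfFin rfl p.2))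
    ?_ ?_ ?_ fun _ _ => rfl
  · intro p hp
    simp only [Finset.mem_filter, Finset.mem_univ, true_and] at hp ⊢
    exact ⟨(s.orderEmbOfFin rfl).strictMono hp, s.orderEmbOfFin_mem rfl _,
      s.orderEmbOfFin_mem rfl _⟩
  · intro p _ q _ hpq
    rw [Prod.mk.injEq] at hpq
    exact Prod.ext ((s.orderEmbOfFin rfl).injective hpq.1) ((s.orderEmbOfFin rfl).injective hpq.2)
  · rintro ⟨i, j⟩ hp
    simp only [Finset.coe_filter, Finset.mem_univ, true_and, Set.mem_ofPred_eq] at hp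
    obtain ⟨hij, hi, hj⟩ := hp
    rw [← Finset.mem_coe, ← s.range_orderEmbOfFin rfl] at hi hj
    obtain ⟨a, rfl⟩ := hi
    obtain ⟨b, rfl⟩ := hj
    exact ⟨(a, b), by simpa using hij, rfl⟩

/-- The internal energy splits over the connected components of `H`. Each costs at most `B` times
its size, and the sizes add up to `n`. -/
theorem neg_le_innerSum_of_mem_stabilityBounds {Φ : ℝ≥0 → EReal} {B : ℝ}
    (hB : B ∈ stabilityBounds d Φ) {n : ℕ} {x : Fin n → EuclideanSpace ℝ (Fin d)}
    {w : Fin n × Fin n → ℝ} (hw : ∀ p : Fin n × Fin n, p.1 < p.2 → Φ ‖x p.1 - x p.2‖₊ = w p)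
    (H : SimpleGraph (Fin n)) :
    -(B * n) ≤ innerSum w (Finset.univ.filter fun p : Fin n × Fin n => p.1 < p.2) H := by
  classical
  have : Fintype H.ConnectedComponent := Fintype.ofFinite _
  have hcard : (n : ℝ) = ∑ c : H.ConnectedComponent,
      ((Finset.univ.filter fun i => H.connectedComponentMk i = c).card : ℝ) := by
    have h := Finset.card_eq_sum_card_fiberwise (f := H.connectedComponentMk)
      (s := Finset.univ) (t := Finset.univ) (by simp)
    rw [Finset.card_univ, Fintype.card_fin] at h
    exact_mod_cast h
  rw [innerSum, ← Finset.sum_fiberwise _ fun p => H.connectedComponentMk p.1, hcard,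
    Finset.mul_sum, ← Finset.sum_neg_distrib]
  refine Finset.sum_le_sum fun c _ => ?_
  refine (neg_le_sum_pairs_of_mem_stabilityBounds hB hw _).trans_eq ?_
  refine Finset.sum_congr ?_ fun _ _ => rfl
  ext p
  simp only [Finset.mem_filter, Finset.mem_univ, true_and, ← SimpleGraph.ConnectedComponent.eq]
  constructor
  · rintro ⟨h, h1, h2⟩
    exact ⟨⟨h, h1.trans h2.symm⟩, h1⟩
  · rintro ⟨⟨h, h1⟩, h2⟩
    exact ⟨h, h2, h1.symm.trans h2⟩

end Stability

/-! ### Null sets of differences and integration over a rooted tree -/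

section Integrals

variable {d : ℕ}

/-- A surjective linear map pulls null sets back to null sets. The exceptional set is first enlarged
to a measurable one, as `q` need not be measurable. -/
theorem ae_sub_of_ae {n : ℕ} {i j : Fin n} (hij : i ≠ j) {q : EuclideanSpace ℝ (Fin d) → Prop}
    (hq : ∀ᵐ y, q y) : ∀ᵐ x : Fin n → EuclideanSpace ℝ (Fin d), q (x i - x j) := by
  let L : (Fin n → EuclideanSpace ℝ (Fin d)) →ₗ[ℝ] EuclideanSpace ℝ (Fin d) :=
    (LinearMap.proj i : (Fin n → EuclideanSpace ℝ (Fin d)) →ₗ[ℝ] EuclideanSpace ℝ (Fin d)) -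
      LinearMap.proj j
  have hL : Function.Surjective L := fun y =>
    ⟨Pi.single i y, by simp [L, hij.symm]⟩
  have h := (ae_comp_linearMap_mem_iff L
    (μ := (volume : Measure (Fin n → EuclideanSpace ℝ (Fin d))))
    (ν := (volume : Measure (EuclideanSpace ℝ (Fin d)))) hL
    (measurableSet_toMeasurable volume {y | ¬ q y}).compl).2 ?_
  · filter_upwards [h] with x hx
    by_contra hc
    exact hx (subset_toMeasurable _ _ hc)
  · rw [ae_iff] at hq ⊢
    simpa using hq

theorem quasiMeasurePreserving_sub {n : ℕ} {i j : Fin n} (hij : i ≠ j) :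
    Measure.QuasiMeasurePreserving
      (fun x : Fin n → EuclideanSpace ℝ (Fin d) => x i - x j) volume volume := by
  have hm : Measurable fun x : Fin n → EuclideanSpace ℝ (Fin d) => x i - x j :=
    (measurable_pi_apply i).sub (measurable_pi_apply j)
  refine ⟨hm, Measure.AbsolutelyContinuous.mk fun s hs h => ?_⟩
  rw [Measure.map_apply hm hs]
  have := ae_sub_of_ae hij (q := fun y => y ∉ s) (by rw [ae_iff]; simpa using h)
  rw [ae_iff] at this
  simp only [not_not] at this
  exact this

/-- Integration of the variables in `s` over a forest with parent map `p`. -/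
theorem lmarginal_prod_parentMap {n : ℕ} {ψ g : EuclideanSpace ℝ (Fin d) → ℝ≥0∞}
    (hψ : Measurable ψ) (hg : Measurable g) {r : Fin n} {p : Fin n → Fin n} {s : Finset (Fin n)}
    (hr : r ∉ s) (hp : IsParentMapOn s p) :
    (∫⋯∫⁻_s, fun x => g (x r) * ∏ v ∈ s, ψ (x v - x (p v)) ∂fun _ => volume) =
      fun x => g (x r) * (∫⁻ y, ψ y) ^ s.card := by
  obtain ⟨rk, hrk⟩ := hp
  -- A vertex of maximal rank is a leaf, so its variable occurs in one factor only and can be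
  -- integrated first. The resulting constant is absorbed into `g`, hence the generalization.
  induction s using Finset.induction_on_max_value rk generalizing g with
  | empty => simp
  | insert v s hv hmax ih =>
    rw [Finset.mem_insert, not_or] at hr
    rw [Finset.forall_mem_insert] at hrk
    have hmeas : Measurable fun x : Fin n → EuclideanSpace ℝ (Fin d) =>
        g (x r) * ∏ w ∈ insert v s, ψ (x w - x (p w)) := by fun_prop
    have hpv : p v ≠ v := fun h => hrk.1.ne (by rw [h])
    rw [lmarginal_insert' _ hmeas hv]
    have hin : (fun x : Fin n → EuclideanSpace ℝ (Fin d) => ∫⁻ y, g (Function.update x v y r) *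
        ∏ w ∈ insert v s, ψ (Function.update x v y w - Function.update x v y (p w))) =
        fun x => (∫⁻ y, ψ y) * g (x r) * ∏ w ∈ s, ψ (x w - x (p w)) := by
      funext x
      have h1 : ∀ y, g (Function.update x v y r) * ∏ w ∈ insert v s,
          ψ (Function.update x v y w - Function.update x v y (p w)) =
          ψ (y - x (p v)) * (g (x r) * ∏ w ∈ s, ψ (x w - x (p w))) := by
        intro y
        rw [Finset.prod_insert hv, Function.update_self, Function.update_of_ne hpv,
          Function.update_of_ne hr.1, mul_left_comm]
        congr 2
        refine Finset.prod_congr rfl fun w hw => ?_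
        rw [Function.update_of_ne (ne_of_mem_of_not_mem hw hv), Function.update_of_ne]
        intro h
        have := hrk.2 w hw
        rw [h] at this
        exact (hmax w hw).not_gt this
      simp_rw [h1]
      rw [lintegral_mul_const _ (by fun_prop), lintegral_sub_right_eq_self, mul_assoc]
    rw [hin]
    have ih' := ih (g := fun y => (∫⁻ y, ψ y) * g y) (hg.const_mul _) hr.2 hrk.2
    rw [ih', Finset.card_insert_of_notMem hv]
    funext x
    ring

theorem lintegral_prod_parentMap {n : ℕ} {ψ : EuclideanSpace ℝ (Fin d) → ℝ≥0∞}
    (hψ : Measurable ψ) {Λ : Set (EuclideanSpace ℝ (Fin d))} (hΛ : MeasurableSet Λ)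
    {r : Fin n} {p : Fin n → Fin n} (hp : IsParentMapOn (Finset.univ.erase r) p) :
    ∫⁻ x : Fin n → EuclideanSpace ℝ (Fin d) in configs n Λ,
      (∏ v ∈ Finset.univ.erase r, ψ (x v - x (p v))) ≤
      volume Λ * (∫⁻ y, ψ y) ^ (n - 1) := by
  have hmeas : Measurable fun x : Fin n → EuclideanSpace ℝ (Fin d) =>
      Λ.indicator 1 (x r) * ∏ v ∈ Finset.univ.erase r, ψ (x v - x (p v)) := by
    have : Measurable (Λ.indicator (1 : EuclideanSpace ℝ (Fin d) → ℝ≥0∞)) :=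
      measurable_one.indicator hΛ
    fun_prop
  calc ∫⁻ x : Fin n → EuclideanSpace ℝ (Fin d) in configs n Λ,
      (∏ v ∈ Finset.univ.erase r, ψ (x v - x (p v)))
      ≤ ∫⁻ x : Fin n → EuclideanSpace ℝ (Fin d) in configs n Λ, Λ.indicator 1 (x r) *
          ∏ v ∈ Finset.univ.erase r, ψ (x v - x (p v)) := by
        refine setLIntegral_mono hmeas fun x hx => ?_
        rw [Set.indicator_of_mem (hx r), Pi.one_apply, one_mul]
    _ ≤ ∫⁻ x : Fin n → EuclideanSpace ℝ (Fin d), Λ.indicator 1 (x r) *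
          ∏ v ∈ Finset.univ.erase r, ψ (x v - x (p v)) :=
        setLIntegral_le_lintegral _ _
    _ = volume Λ * (∫⁻ y, ψ y) ^ (n - 1) := by
        -- Only the root is kept in `Λ`, and it is integrated last. The base point `0` is irrelevant
        -- since every variable is integrated.
        rw [volume_pi, lintegral_eq_lmarginal_univ 0, lmarginal_erase _ hmeas (Finset.mem_univ r),
          lmarginal_prod_parentMap hψ (measurable_one.indicator hΛ) (Finset.notMem_erase r _) hp]
        simp only [Function.update_self]
        rw [lintegral_mul_const _ (measurable_one.indicator hΛ), lintegral_indicator_one hΛ,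
          Finset.card_erase_of_mem (Finset.mem_univ r), Finset.card_univ, Fintype.card_fin]

end Integrals

end MayerGas

namespace MayerGas

/-! ### Pointwise bound on the Ursell function -/

section PointwiseBound

variable {d : ℕ} {V Φ₁ Φ₂ : ℝ≥0 → EReal}

theorem ursell_eq_spanSum {n : ℕ} (β : ℝ) (V : ℝ≥0 → EReal)
    (x : Fin n → EuclideanSpace ℝ (Fin d)) :
    ursell β V x = spanSum SimpleGraph.Connected
      (fun p => boltzmann β (V ‖x p.1 - x p.2‖₊) - 1)
      (Finset.univ.filter fun p : Fin n × Fin n => p.1 < p.2) ⊥ := by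
  rw [spanSum_bot_eq_sum_graphs, ursell]
  congr!

/-- The weight `|e^{-β Φ₁(|y|)} - 1| + β |Φ₂(|y|)|` of an edge, as a real number. -/
noncomputable def edgeWeight (β : ℝ) (Φ₁ Φ₂ : ℝ≥0 → EReal) (y : EuclideanSpace ℝ (Fin d)) : ℝ :=
  |boltzmann β (Φ₁ ‖y‖₊) - 1| + |β * (Φ₂ ‖y‖₊).toReal|

theorem edgeWeight_nonneg (β : ℝ) (Φ₁ Φ₂ : ℝ≥0 → EReal) (y : EuclideanSpace ℝ (Fin d)) :
    0 ≤ edgeWeight β Φ₁ Φ₂ y :=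
  add_nonneg (abs_nonneg _) (abs_nonneg _)

theorem ofReal_edgeWeight {β : ℝ} (hβ : 0 < β) {y : EuclideanSpace ℝ (Fin d)}
    (hy : (Φ₂ ‖y‖₊).abs < ∞) :
    ENNReal.ofReal (edgeWeight β Φ₁ Φ₂ y) =
      ENNReal.ofReal |boltzmann β (Φ₁ ‖y‖₊) - 1| + ENNReal.ofReal β * (Φ₂ ‖y‖₊).abs := by
  rw [edgeWeight, ENNReal.ofReal_add (abs_nonneg _) (abs_nonneg _)]
  congr 1
  generalize Φ₂ ‖y‖₊ = v at hy
  induction v with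
  | bot => simp at hy
  | top => simp at hy
  | coe t => rw [EReal.toReal_coe, EReal.abs_def, abs_mul, abs_of_pos hβ, ENNReal.ofReal_mul hβ.le]

theorem eq_coe_toReal_of_abs_lt_top {v : EReal} (hv : v.abs < ∞) : v = (v.toReal : EReal) := by
  induction v with
  | bot => simp at hv
  | top => simp at hv
  | coe t => rw [EReal.toReal_coe]

/-- Tree-graph bound for the Ursell function of a Ruelle potential. -/
theorem abs_ursell_le (hV : IsRuelle d V Φ₁ Φ₂) {β : ℝ} (hβ : 0 < β) {n : ℕ} (r : Fin n)
    {x : Fin n → EuclideanSpace ℝ (Fin d)}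
    (hx : ∀ i j, i ≠ j → (Φ₂ ‖x i - x j‖₊).abs < ∞) :
    |ursell β V x| ≤ Real.exp (β * stabilityConst d Φ₂ * n) *
      ∑ p ∈ parentMaps r, ∏ v ∈ Finset.univ.erase r, edgeWeight β Φ₁ Φ₂ (x v - x (p v)) := by
  have hsymm : ∀ i j, edgeWeight β Φ₁ Φ₂ (x i - x j) = edgeWeight β Φ₁ Φ₂ (x j - x i) := by
    intro i j
    rw [edgeWeight, edgeWeight, ← nnnorm_neg, neg_sub]
  have htree := spanSum_isTree_le_sum_parentMaps r
    (F := fun p => edgeWeight β Φ₁ Φ₂ (x p.1 - x p.2)) (fun _ => edgeWeight_nonneg _ _ _ _) hsymm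
  have hfin : ∀ p : Fin n × Fin n, p.1 < p.2 →
      Φ₂ ‖x p.1 - x p.2‖₊ = ((Φ₂ ‖x p.1 - x p.2‖₊).toReal : EReal) :=
    fun p hp => eq_coe_toReal_of_abs_lt_top (hx _ _ hp.ne)
  have hboltz : ∀ p : Fin n × Fin n, p.1 < p.2 → boltzmann β (V ‖x p.1 - x p.2‖₊) =
      boltzmann β (Φ₁ ‖x p.1 - x p.2‖₊) *
        Real.exp (-(β * (Φ₂ ‖x p.1 - x p.2‖₊).toReal)) := by
    intro p hp
    rw [hV.eq_add, ← boltzmann_add_coe hβ (hV.isPairPotential₁.ne_bot _), ← hfin p hp]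
  rw [ursell_eq_spanSum]
  refine (abs_spanSum_connected_le (u := fun p => β * (Φ₂ ‖x p.1 - x p.2‖₊).toReal)
    (F := fun p => edgeWeight β Φ₁ Φ₂ (x p.1 - x p.2))
    (fun _ _ => edgeWeight_nonneg _ _ _ _) ?_ ?_ fun H => ?_).trans
    (mul_le_mul_of_nonneg_left htree (Real.exp_nonneg _))
  · intro p hp
    rw [add_sub_cancel, abs_of_nonneg (boltzmann_nonneg _ _), hboltz p (Finset.mem_filter.1 hp).2]
    exact mul_le_of_le_one_left (Real.exp_nonneg _) (boltzmann_le_one hβ (hV.nonneg₁ _))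
  · intro p hp
    rw [hboltz p (Finset.mem_filter.1 hp).2]
    exact abs_mul_exp_sub_one_le (boltzmann_nonneg _ _) (boltzmann_le_one hβ (hV.nonneg₁ _)) _
  · have h := neg_le_innerSum_of_mem_stabilityBounds (stabilityConst_mem hV.stable₂) hfin H
    rw [innerSum, ← Finset.mul_sum]
    rw [innerSum] at h
    calc -(β * stabilityConst d Φ₂ * n) = β * -(stabilityConst d Φ₂ * n) := by ring
      _ ≤ _ := mul_le_mul_of_nonneg_left h hβ.le

end PointwiseBound

/-! ### Finiteness of the Ruelle integral, integrated bounds and the geometric majorant -/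

section RuelleIntegral

variable {d : ℕ} {V Φ₁ Φ₂ : ℝ≥0 → EReal}

theorem aemeasurable_abs_boltzmann_sub_one (β : ℝ) {Φ : ℝ≥0 → EReal} (h : IsPairPotential d Φ) :
    AEMeasurable (fun x : EuclideanSpace ℝ (Fin d) =>
      ENNReal.ofReal |boltzmann β (Φ ‖x‖₊) - 1|) volume := by
  have h1 := (measurable_boltzmann β).comp_aemeasurable h.aemeasurable
  have h2 : Measurable fun t : ℝ => ENNReal.ofReal |t - 1| := by fun_prop
  exact h2.comp_aemeasurable h1

theorem measurable_ereal_abs : Measurable EReal.abs := by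
  have h : ∀ v : EReal, v.abs = max v.toENNReal (-v).toENNReal := by
    intro v
    induction v with
    | bot => simp
    | top => simp
    | coe t =>
      rw [← EReal.coe_neg, EReal.toENNReal_of_ne_top (EReal.coe_ne_top _),
        EReal.toENNReal_of_ne_top (EReal.coe_ne_top _), EReal.abs_def, EReal.toReal_coe,
        EReal.toReal_coe, abs_eq_max_neg]
      exact ENNReal.ofReal_mono.map_max
  rw [funext h]
  exact measurable_ereal_toENNReal.max (measurable_ereal_toENNReal.comp continuous_neg.measurable)

theorem aemeasurable_abs {Φ : ℝ≥0 → EReal} (h : IsPairPotential d Φ) :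
    AEMeasurable (fun x : EuclideanSpace ℝ (Fin d) => (Φ ‖x‖₊).abs) volume :=
  measurable_ereal_abs.comp_aemeasurable h.aemeasurable

/-- Far away `1 - e^{-t} ≤ t` reduces to temperedness; inside the ball of radius `r₀` the integrand
is at most `1`, whatever the singularity of `Φ`. -/
theorem lintegral_abs_boltzmann_sub_one_lt_top {β : ℝ} (hβ : 0 < β) {Φ : ℝ≥0 → EReal}
    (h0 : ∀ r, 0 ≤ Φ r) (ht : IsTempered d Φ) :
    ∫⁻ x : EuclideanSpace ℝ (Fin d), ENNReal.ofReal |boltzmann β (Φ ‖x‖₊) - 1| < ∞ := by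
  obtain ⟨r₀, -, hr⟩ := ht
  have hS : MeasurableSet {x : EuclideanSpace ℝ (Fin d) | r₀ ≤ ‖x‖} :=
    measurableSet_le measurable_const measurable_norm
  rw [← lintegral_add_compl _ hS]
  refine ENNReal.add_lt_top.2 ⟨?_, ?_⟩
  · refine (lintegral_mono fun x => ofReal_abs_boltzmann_sub_one_le hβ (h0 _)).trans_lt ?_
    rw [lintegral_const_mul' _ _ ENNReal.ofReal_ne_top]
    exact ENNReal.mul_lt_top ENNReal.ofReal_lt_top hr
  · refine (lintegral_mono (g := fun _ => 1) fun x => ?_).trans_lt ?_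
    · rw [← ENNReal.ofReal_one]
      exact ENNReal.ofReal_le_ofReal (abs_boltzmann_sub_one_le_one hβ (h0 _))
    · rw [setLIntegral_one]
      refine (measure_mono fun x hx => ?_).trans_lt
        (measure_ball_lt_top (x := (0 : EuclideanSpace ℝ (Fin d))) (r := r₀))
      simpa using hx

theorem ruelleIntegral_lt_top (hV : IsRuelle d V Φ₁ Φ₂) {β : ℝ} (hβ : 0 < β) :
    ruelleIntegral d β Φ₁ Φ₂ < ∞ := by
  rw [ruelleIntegral, lintegral_add_left' (aemeasurable_abs_boltzmann_sub_one β
    hV.isPairPotential₁), lintegral_const_mul' _ _ ENNReal.ofReal_ne_top]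
  exact ENNReal.add_lt_top.2 ⟨lintegral_abs_boltzmann_sub_one_lt_top hβ hV.nonneg₁ hV.tempered₁,
    ENNReal.mul_lt_top ENNReal.ofReal_lt_top hV.absIntegrable₂⟩

theorem aestronglyMeasurable_ursell (hV : IsPairPotential d V) (β : ℝ) (n : ℕ) :
    AEStronglyMeasurable (ursell β V : (Fin n → EuclideanSpace ℝ (Fin d)) → ℝ) volume := by
  refine AEMeasurable.aestronglyMeasurable ?_
  classical
  unfold ursell
  refine Finset.aemeasurable_fun_sum _ fun g _ => Finset.aemeasurable_fun_prod _ fun p hp => ?_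
  have h := (hV.aemeasurable.comp_quasiMeasurePreserving
    (quasiMeasurePreserving_sub (d := d) (Finset.mem_filter.1 hp).2.1.ne))
  exact ((measurable_boltzmann β).comp_aemeasurable h).sub_const 1

theorem lintegral_ursell_le (hV : IsRuelle d V Φ₁ Φ₂) {β : ℝ} (hβ : 0 < β) {n : ℕ} (hn : 1 ≤ n)
    {Λ : Set (EuclideanSpace ℝ (Fin d))} (hΛ : MeasurableSet Λ) :
    ∫⁻ x in configs n Λ, ENNReal.ofReal |ursell β V x| ≤
      ENNReal.ofReal (Real.exp (β * stabilityConst d Φ₂ * n)) *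
        ((n : ℝ≥0∞) ^ (n - 2) * (volume Λ * ruelleIntegral d β Φ₁ Φ₂ ^ (n - 1))) := by
  let r : Fin n := ⟨0, hn⟩
  have hmeas : AEMeasurable (fun x : EuclideanSpace ℝ (Fin d) =>
      ENNReal.ofReal |boltzmann β (Φ₁ ‖x‖₊) - 1| + ENNReal.ofReal β * (Φ₂ ‖x‖₊).abs) volume :=
    (aemeasurable_abs_boltzmann_sub_one β hV.isPairPotential₁).add
      ((aemeasurable_abs hV.isPairPotential₂).const_mul _)
  have hfin : ∀ᵐ y : EuclideanSpace ℝ (Fin d), (Φ₂ ‖y‖₊).abs < ∞ :=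
    ae_lt_top' (aemeasurable_abs hV.isPairPotential₂) hV.absIntegrable₂.ne
  -- Pair potentials are only a.e. measurable, whereas the iterated integration needs a measurable
  -- weight. It is replaced by `hmeas.mk`, with equality at all differences `x i - x j` off a null
  -- set; there `Φ₂` is also finite.
  have hw : ∀ᵐ y : EuclideanSpace ℝ (Fin d), (Φ₂ ‖y‖₊).abs < ∞ ∧
      ENNReal.ofReal (edgeWeight β Φ₁ Φ₂ y) = hmeas.mk _ y := by
    filter_upwards [hfin, hmeas.ae_eq_mk] with y h1 h2
    exact ⟨h1, (ofReal_edgeWeight hβ h1).trans h2⟩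
  have hpairs : ∀ᵐ x : Fin n → EuclideanSpace ℝ (Fin d), ∀ i j, i ≠ j →
      (Φ₂ ‖x i - x j‖₊).abs < ∞ ∧
      ENNReal.ofReal (edgeWeight β Φ₁ Φ₂ (x i - x j)) = hmeas.mk _ (x i - x j) := by
    rw [ae_all_iff]
    intro i
    rw [ae_all_iff]
    intro j
    rw [ae_all_iff]
    exact fun hij => ae_sub_of_ae hij hw
  have hψ : ∫⁻ y, hmeas.mk _ y = ruelleIntegral d β Φ₁ Φ₂ :=
    (lintegral_congr_ae hmeas.ae_eq_mk).symm
  have hbound : ∀ᵐ x : Fin n → EuclideanSpace ℝ (Fin d), ENNReal.ofReal |ursell β V x| ≤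
      ENNReal.ofReal (Real.exp (β * stabilityConst d Φ₂ * n)) *
        ∑ p ∈ parentMaps r, ∏ v ∈ Finset.univ.erase r, hmeas.mk _ (x v - x (p v)) := by
    filter_upwards [hpairs] with x hx
    refine (ENNReal.ofReal_le_ofReal
      (abs_ursell_le hV hβ r fun i j hij => (hx i j hij).1)).trans_eq ?_
    rw [ENNReal.ofReal_mul (Real.exp_nonneg _), ENNReal.ofReal_sum_of_nonneg fun p _ =>
      Finset.prod_nonneg fun v _ => edgeWeight_nonneg _ _ _ _]
    congr 1
    refine Finset.sum_congr rfl fun p hp => ?_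
    rw [ENNReal.ofReal_prod_of_nonneg fun v _ => edgeWeight_nonneg _ _ _ _]
    exact Finset.prod_congr rfl fun v hv =>
      (hx _ _ ((mem_parentMaps.1 hp).2.apply_ne hv).symm).2
  have hprod : ∀ p ∈ parentMaps r, Measurable fun x : Fin n → EuclideanSpace ℝ (Fin d) =>
      ∏ v ∈ Finset.univ.erase r, hmeas.mk _ (x v - x (p v)) :=
    fun p _ => Finset.measurable_fun_prod _ fun v _ => hmeas.measurable_mk.comp
      ((measurable_pi_apply v).sub (measurable_pi_apply (p v)))
  refine (lintegral_mono_ae (ae_restrict_of_ae hbound)).trans ?_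
  rw [lintegral_const_mul' _ _ ENNReal.ofReal_ne_top, lintegral_finsetSum _ hprod]
  gcongr
  calc _ ≤ ∑ p ∈ parentMaps r, volume Λ * ruelleIntegral d β Φ₁ Φ₂ ^ (n - 1) :=
        Finset.sum_le_sum fun p hp => hψ ▸
          lintegral_prod_parentMap hmeas.measurable_mk hΛ (mem_parentMaps.1 hp).2
    _ = (parentMaps r).card * (volume Λ * ruelleIntegral d β Φ₁ Φ₂ ^ (n - 1)) := by
        rw [Finset.sum_const, nsmul_eq_mul]
    _ ≤ _ := by
        gcongr
        have := card_parentMaps_le r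
        rw [Fintype.card_fin] at this
        exact_mod_cast this

theorem IsCubicBox.isCompact {Λ : Set (EuclideanSpace ℝ (Fin d))} (h : IsCubicBox Λ) :
    IsCompact Λ := by
  obtain ⟨a, L, -, rfl⟩ := h
  have hc : IsCompact (Set.univ.pi fun i => Set.Icc (a i) (a i + L)) :=
    isCompact_univ_pi fun i => isCompact_Icc
  convert hc.image (PiLp.continuous_toLp 2 fun _ : Fin d => ℝ)
  ext x
  constructor
  · exact fun hx => ⟨x.ofLp, fun i _ => hx i, rfl⟩
  · rintro ⟨y, hy, rfl⟩ i
    exact hy i trivial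

theorem pow_sub_two_eq_zpow {n : ℕ} (hn : 1 ≤ n) : (n : ℝ) ^ (n - 2) = (n : ℝ) ^ ((n : ℤ) - 2) := by
  rcases hn.eq_or_lt with rfl | hn
  · simp
  · rw [← zpow_natCast, Nat.cast_sub hn]
    rfl

theorem integrableOn_ursell (hV : IsRuelle d V Φ₁ Φ₂) {β : ℝ} (hβ : 0 < β) {n : ℕ} (hn : 1 ≤ n)
    {Λ : Set (EuclideanSpace ℝ (Fin d))} (hΛ : IsCompact Λ) :
    IntegrableOn (ursell β V) (configs n Λ) volume := by
  refine ⟨(aestronglyMeasurable_ursell hV.admissible.isPairPotential β n).restrict, ?_⟩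
  rw [hasFiniteIntegral_iff_norm]
  refine (lintegral_ursell_le hV hβ hn hΛ.measurableSet).trans_lt ?_
  exact ENNReal.mul_lt_top ENNReal.ofReal_lt_top (ENNReal.mul_lt_top
    (ENNReal.pow_lt_top (ENNReal.natCast_lt_top n)) (ENNReal.mul_lt_top hΛ.measure_lt_top
      (ENNReal.pow_lt_top (ruelleIntegral_lt_top hV hβ))))

theorem abs_mayerCoeff_le (hV : IsRuelle d V Φ₁ Φ₂) {β : ℝ} (hβ : 0 < β) {n : ℕ} (hn : 1 ≤ n)
    {Λ : Set (EuclideanSpace ℝ (Fin d))} (hΛ : IsCompact Λ) :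
    |mayerCoeff β V n Λ| ≤ Real.exp (β * stabilityConst d Φ₂ * n) * (n : ℝ) ^ ((n : ℤ) - 2) *
      ((ruelleIntegral d β Φ₁ Φ₂).toReal ^ (n - 1) / (n ! : ℝ)) := by
  have hI : |∫ x in configs n Λ, ursell β V x| ≤
      Real.exp (β * stabilityConst d Φ₂ * n) * ((n : ℝ) ^ (n - 2) *
        ((volume Λ).toReal * (ruelleIntegral d β Φ₁ Φ₂).toReal ^ (n - 1))) := by
    have h := ENNReal.toReal_mono ?_ (lintegral_ursell_le hV hβ hn hΛ.measurableSet)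
    · rw [ENNReal.toReal_mul, ENNReal.toReal_mul, ENNReal.toReal_mul, ENNReal.toReal_pow,
        ENNReal.toReal_pow, ENNReal.toReal_natCast, ENNReal.toReal_ofReal (Real.exp_nonneg _)] at h
      rw [← Real.norm_eq_abs]
      exact (norm_integral_le_lintegral_norm _).trans h
    · exact (ENNReal.mul_lt_top ENNReal.ofReal_lt_top (ENNReal.mul_lt_top
        (ENNReal.pow_lt_top (ENNReal.natCast_lt_top n)) (ENNReal.mul_lt_top hΛ.measure_lt_top
          (ENNReal.pow_lt_top (ruelleIntegral_lt_top hV hβ))))).ne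
  rw [← pow_sub_two_eq_zpow hn, mayerCoeff, abs_mul, abs_of_nonneg (by positivity)]
  calc 1 / (volume Λ).toReal * (1 / (n ! : ℝ)) * |∫ x in configs n Λ, ursell β V x|
      ≤ 1 / (volume Λ).toReal * (1 / (n ! : ℝ)) *
          (Real.exp (β * stabilityConst d Φ₂ * n) * ((n : ℝ) ^ (n - 2) *
        ((volume Λ).toReal * (ruelleIntegral d β Φ₁ Φ₂).toReal ^ (n - 1)))) := by gcongr
    _ = ((volume Λ).toReal⁻¹ * (volume Λ).toReal) * (Real.exp (β * stabilityConst d Φ₂ * n) *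
          (n : ℝ) ^ (n - 2) * ((ruelleIntegral d β Φ₁ Φ₂).toReal ^ (n - 1) / (n ! : ℝ))) := by
        ring
    -- `a⁻¹ * a ≤ 1` holds for `a = 0` too, so a null `Λ` needs no separate case.
    _ ≤ _ := mul_le_of_le_one_left (by positivity) (inv_mul_le_one (a := (volume Λ).toReal))

/-- `n ^ n / n!` is one term of the series of `exp n`. This is the source of the `+ 1` in the
exponent of the convergence radius. -/
theorem zpow_sub_two_div_factorial_le_exp {n : ℕ} (hn : 1 ≤ n) :
    (n : ℝ) ^ ((n : ℤ) - 2) / (n ! : ℝ) ≤ Real.exp n := by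
  refine le_trans ?_ (Real.pow_div_factorial_le_exp (n : ℝ) n.cast_nonneg n)
  rw [← pow_sub_two_eq_zpow hn]
  gcongr
  · exact_mod_cast hn
  · omega

theorem norm_mayerCoeff_mul_pow_le (hV : IsRuelle d V Φ₁ Φ₂) {β : ℝ} (hβ : 0 < β)
    {Λ : Set (EuclideanSpace ℝ (Fin d))} (hΛ : IsCompact Λ) (z : ℂ) (n : ℕ) :
    ‖(mayerCoeff β V (n + 1) Λ : ℂ) * z ^ (n + 1)‖ ≤
      ‖z‖ * Real.exp (β * stabilityConst d Φ₂ + 1) *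
        (‖z‖ * (Real.exp (β * stabilityConst d Φ₂ + 1) *
          (ruelleIntegral d β Φ₁ Φ₂).toReal)) ^ n := by
  rw [norm_mul, norm_pow, Complex.norm_real, Real.norm_eq_abs]
  set b := β * stabilityConst d Φ₂
  set C := (ruelleIntegral d β Φ₁ Φ₂).toReal
  have hC : 0 ≤ C := ENNReal.toReal_nonneg
  have h1 := abs_mayerCoeff_le hV hβ (Nat.le_add_left 1 n) hΛ
  have h2 := zpow_sub_two_div_factorial_le_exp (Nat.le_add_left 1 n)
  rw [Nat.add_sub_cancel] at h1
  calc |mayerCoeff β V (n + 1) Λ| * ‖z‖ ^ (n + 1)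
      ≤ Real.exp (b * (n + 1 : ℕ)) * ((n + 1 : ℕ) : ℝ) ^ (((n + 1 : ℕ) : ℤ) - 2) *
          (C ^ n / ((n + 1) ! : ℝ)) * ‖z‖ ^ (n + 1) := by gcongr
    _ = Real.exp (b * (n + 1 : ℕ)) * (((n + 1 : ℕ) : ℝ) ^ (((n + 1 : ℕ) : ℤ) - 2) /
          ((n + 1) ! : ℝ)) * C ^ n * ‖z‖ ^ (n + 1) := by ring
    _ ≤ Real.exp (b * (n + 1 : ℕ)) * Real.exp (n + 1 : ℕ) * C ^ n * ‖z‖ ^ (n + 1) := by gcongr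
    _ = Real.exp (b + 1) ^ (n + 1) * C ^ n * ‖z‖ ^ (n + 1) := by
        rw [← Real.exp_add, ← Real.exp_nat_mul]
        ring_nf
    _ = _ := by ring

end RuelleIntegral

end MayerGas
-- The Mayer bound and uniform convergence
theorem theorem2 (d : ℕ) (hd : 1 ≤ d) (V Φ₁ Φ₂ : ℝ≥0 → EReal)
    (hV : MayerGas.IsRuelle d V Φ₁ Φ₂) (β : ℝ) (hβ : 0 < β) :
    -- the constant `C̃(β)` is finite
    MayerGas.ruelleIntegral d β Φ₁ Φ₂ < ∞ ∧
    -- the Mayer coefficients are given by convergent integrals and satisfy the bound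
    (∀ Λ : Set (EuclideanSpace ℝ (Fin d)), MayerGas.IsCubicBox Λ → ∀ n : ℕ, 1 ≤ n →
      IntegrableOn (MayerGas.ursell β V) (MayerGas.configs n Λ) volume ∧
      |MayerGas.mayerCoeff β V n Λ| ≤
        Real.exp (β * MayerGas.stabilityConst d Φ₂ * n) * (n : ℝ) ^ ((n : ℤ) - 2) *
          ((MayerGas.ruelleIntegral d β Φ₁ Φ₂).toReal ^ (n - 1) / (n ! : ℝ))) ∧
    -- the Mayer series `∑_{n ≥ 1} C_n(β, Λ) z^n` converges absolutely, uniformly in `Λ`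
    (∀ z : ℂ,
      ‖z‖ * (Real.exp (β * MayerGas.stabilityConst d Φ₂ + 1) *
        (MayerGas.ruelleIntegral d β Φ₁ Φ₂).toReal) < 1 →
      (∀ Λ : Set (EuclideanSpace ℝ (Fin d)), MayerGas.IsCubicBox Λ →
        Summable fun n : ℕ => ‖(MayerGas.mayerCoeff β V (n + 1) Λ : ℂ) * z ^ (n + 1)‖) ∧
      TendstoUniformlyOn
        (fun (N : ℕ) (Λ : Set (EuclideanSpace ℝ (Fin d))) =>
          ∑ n ∈ Finset.range N, ‖(MayerGas.mayerCoeff β V (n + 1) Λ : ℂ) * z ^ (n + 1)‖)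
        (fun Λ => ∑' n : ℕ, ‖(MayerGas.mayerCoeff β V (n + 1) Λ : ℂ) * z ^ (n + 1)‖)
        atTop {Λ | MayerGas.IsCubicBox Λ}) := by
  refine ⟨MayerGas.ruelleIntegral_lt_top hV hβ, fun Λ hΛ n hn =>
    ⟨MayerGas.integrableOn_ursell hV hβ hn hΛ.isCompact,
      MayerGas.abs_mayerCoeff_le hV hβ hn hΛ.isCompact⟩, fun z hz => ?_⟩
  -- The geometric majorant does not involve `Λ`, so the Weierstrass test gives convergence
  -- uniformly over boxes.
  have hsum := (summable_geometric_of_lt_one (by positivity) hz).mul_left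
    (‖z‖ * Real.exp (β * MayerGas.stabilityConst d Φ₂ + 1))
  have hle := fun (n : ℕ) (Λ : Set (EuclideanSpace ℝ (Fin d))) (hΛ : MayerGas.IsCubicBox Λ) =>
    MayerGas.norm_mayerCoeff_mul_pow_le hV hβ hΛ.isCompact z n
  exact ⟨fun Λ hΛ => hsum.of_nonneg_of_le (fun _ => norm_nonneg _) fun n => hle n Λ hΛ,
    tendstoUniformlyOn_tsum_nat hsum fun n Λ hΛ => by
      rw [norm_norm]
      exact hle n Λ hΛ⟩
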